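/- Let $p$ be an odd prime and let $G$ be a group that can be generated by four elements (possibly by fewer), that is nilpotent of class at most $2$, and that satisfies $g^p=1$ for all $g\in G$. Then exactly one of the following holds: (i) $G$ is cyclic and nontrivial; (ii) $G$ is extra-special of order $p^5$ and exponent $p$; (iii) $G$ is capable, that is, there exists a group $K$ such that $G\cong K/Z(K)$. Here a finite $p$-group is called extra-special if its center has order $p$ and its central quotient is a nontrivial elementary abelian $p$-group. -/

import Mathlib

universe u

/-- A group `G` is capable if it is isomorphic to the central quotient `K / Z(K)` of some group `K`.
There is no loss in taking `K` in the universe of `G`: the subgroup of `K` generated by a set of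
coset representatives of `Z(K)` has the same central quotient, and its cardinality is at most
`max |G| ℵ₀`. -/
def IsCapable (G : Type u) [Group G] : Prop :=
  ∃ (K : Type u) (_ : Group K), Nonempty (G ≃* K ⧸ Subgroup.center K)

/-- An extra-special `p`-group: a finite `p`-group whose center has order `p` and whose central
quotient is a nontrivial elementary abelian `p`-group. -/
structure IsExtraSpecial (p : ℕ) (G : Type u) [Group G] : Prop where
  card_eq_pow : ∃ n : ℕ, Nat.card G = p ^ n
  card_center : Nat.card (Subgroup.center G) = p
  nontrivial_quotient : Nontrivial (G ⧸ Subgroup.center G)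
  comm_quotient : ∀ a b : G ⧸ Subgroup.center G, a * b = b * a
  pow_quotient : ∀ a : G ⧸ Subgroup.center G, a ^ p = 1

/-- A group is `k`-generated if it is generated by `k` elements, not necessarily distinct
(so it may need fewer). -/
def IsGeneratedBy (k : ℕ) (G : Type u) [Group G] : Prop :=
  ∃ g : Fin k → G, Subgroup.closure (Set.range g) = ⊤

/-- Exactly one of three propositions holds. -/
def ExactlyOne (P Q R : Prop) : Prop :=
  (P ∧ ¬ Q ∧ ¬ R) ∨ (¬ P ∧ Q ∧ ¬ R) ∨ (¬ P ∧ ¬ Q ∧ R)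

/-!
A group `G` is capable as soon as every nontrivial central element `g` is detected by some
2-cocycle, in the sense that the lifts of `g` to the corresponding central extension are not
central. The Baer correspondence turns `G` into a vector space `L` over `ZMod p` with an alternating
bracket, which factors through the quotient `V` of `L` by its derived subspace. Every pairing
`B : V × L → ZMod p` with vanishing cyclic sums `B(x, ⁅y, z⁆) + B(y, ⁅z, x⁆) + B(z, ⁅x, y⁆)` is the
leading term of a cocycle.

A central element outside the derived subspace is detected by a product of two linear forms unless
`G` is cyclic. For `g` in the derived subspace, the `n`-dimensional space `V ⊗ g`, `n = dim V`, is
compared with the cyclic sums `x ⊗ ⁅y, z⁆ + y ⊗ ⁅z, x⁆ + z ⊗ ⁅x, y⁆`, which span a space of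
dimension at most `n.choose 3`: if `g` is not detected, then these sums span a space containing
`V ⊗ g`. As `n ≤ 4`, this forces `n = 4` and equality, and then the bracket is a symplectic form on
`V` with values in the line of `g`, that is, `G` is extra-special of order `p ^ 5`.

Conversely, in an extra-special group of order larger than `p ^ 3` the centralizer of any `u` is not
abelian, so it contains `a` and `b` whose commutator generates the center. In a group with central
quotient `G`, the lifts of `⁅a, b⁆` then commute with the lifts of `u`, and hence so do all lifts of
central elements of `G`. As `u` was arbitrary, those lifts are central, which is absurd.
-/

open scoped commutatorElement IsMulCommutative TensorProduct

/-! ### Central extensions and capability -/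

/-- A normalized 2-cocycle of `G` with values in `A`, on which `G` acts trivially. -/
structure NormalizedCocycle (G A : Type*) [Group G] [AddCommGroup A] where
  toFun : G → G → A
  one_left : ∀ x, toFun 1 x = 0
  one_right : ∀ x, toFun x 1 = 0
  cocycle : ∀ x y z, toFun x y + toFun (x * y) z = toFun y z + toFun x (y * z)

/-- Some central extension of `G` by `A` does not lift the relation `u * g = g * u`, so that no lift
of `g` is central in it. A central element is detected for some `A` exactly when it lies
outside the epicenter of `G`. -/
def IsDetected {G : Type*} [Group G] (A : Type*) [AddCommGroup A] (g : G) : Prop :=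
  ∃ (c : NormalizedCocycle G A) (u : G), c.toFun u g ≠ c.toFun g u

namespace NormalizedCocycle

variable {G A : Type*} [Group G] [AddCommGroup A]

/-- The cocycle with values in a power of `A` whose components are the given cocycles. -/
def pi {ι : Type*} (c : ι → NormalizedCocycle G A) : NormalizedCocycle G (ι → A) where
  toFun x y i := (c i).toFun x y
  one_left x := funext fun i => (c i).one_left x
  one_right x := funext fun i => (c i).one_right x
  cocycle x y z := funext fun i => (c i).cocycle x y z

/-- The central extension of `G` by `A` with factor set `c`. -/
@[ext]
structure Extension (c : NormalizedCocycle G A) where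
  base : G
  fiber : A

namespace Extension

variable {c : NormalizedCocycle G A}

instance : Mul c.Extension :=
  ⟨fun x y => ⟨x.base * y.base, x.fiber + y.fiber + c.toFun x.base y.base⟩⟩

instance : One c.Extension := ⟨⟨1, 0⟩⟩

instance : Inv c.Extension := ⟨fun x => ⟨x.base⁻¹, -x.fiber - c.toFun x.base⁻¹ x.base⟩⟩

@[simp] theorem base_mul (x y : c.Extension) : (x * y).base = x.base * y.base := rfl

@[simp] theorem fiber_mul (x y : c.Extension) :
    (x * y).fiber = x.fiber + y.fiber + c.toFun x.base y.base := rfl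

@[simp] theorem base_one : (1 : c.Extension).base = 1 := rfl

@[simp] theorem fiber_one : (1 : c.Extension).fiber = 0 := rfl

@[simp] theorem base_inv (x : c.Extension) : x⁻¹.base = x.base⁻¹ := rfl

@[simp] theorem fiber_inv (x : c.Extension) :
    x⁻¹.fiber = -x.fiber - c.toFun x.base⁻¹ x.base := rfl

instance : Group c.Extension :=
  Group.ofLeftAxioms
    (fun x y z => Extension.ext (mul_assoc _ _ _) <| by
      have h := c.cocycle x.base y.base z.base
      simp only [fiber_mul, base_mul]
      calc _ = x.fiber + y.fiber + z.fiber +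
            (c.toFun x.base y.base + c.toFun (x.base * y.base) z.base) := by abel
        _ = _ := by rw [h]; abel)
    (fun x => Extension.ext (one_mul _) <| by simp [c.one_left])
    (fun x => Extension.ext (inv_mul_cancel _) <| by
      simp only [fiber_mul, fiber_inv, base_inv, fiber_one]
      abel)

/-- The projection of the central extension onto its base. -/
def proj (c : NormalizedCocycle G A) : c.Extension →* G where
  toFun := base
  map_one' := rfl
  map_mul' _ _ := rfl

theorem proj_surjective : Function.Surjective (proj c) := fun x => ⟨⟨x, 0⟩, rfl⟩

theorem ker_proj_eq_center
    (h : ∀ g ∈ Subgroup.center G, g ≠ 1 → ∃ u, c.toFun u g ≠ c.toFun g u) :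
    (proj c).ker = Subgroup.center c.Extension := by
  ext x
  rw [MonoidHom.mem_ker, Subgroup.mem_center_iff]
  change x.base = 1 ↔ _
  constructor
  · intro hx y
    ext <;> simp [hx, c.one_left, c.one_right, add_comm]
  · intro hx
    by_contra hne
    have hcenter : x.base ∈ Subgroup.center G :=
      Subgroup.mem_center_iff.2 fun y => congrArg base (hx ⟨y, 0⟩)
    obtain ⟨u, hu⟩ := h _ hcenter hne
    exact hu (by simpa using congrArg fiber (hx ⟨u, 0⟩))

end Extension

end NormalizedCocycle

theorem isCapable_of_forall_isDetected {G : Type u} [Group G] (A : Type) [AddCommGroup A]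
    (h : ∀ g ∈ Subgroup.center G, g ≠ 1 → IsDetected A g) : IsCapable G := by
  choose c hc using fun g : {g : G // g ∈ Subgroup.center G ∧ g ≠ 1} => h g g.2.1 g.2.2
  let C := NormalizedCocycle.pi c
  have hker : (NormalizedCocycle.Extension.proj C).ker = Subgroup.center C.Extension :=
    NormalizedCocycle.Extension.ker_proj_eq_center fun g hg hg1 =>
      (hc ⟨g, hg, hg1⟩).imp fun _ hu hC => hu (congrFun hC ⟨g, hg, hg1⟩)
  exact ⟨C.Extension, inferInstance,
    ⟨(QuotientGroup.quotientKerEquivOfSurjective _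
      NormalizedCocycle.Extension.proj_surjective).symm.trans
      (QuotientGroup.quotientMulEquivOfEq hker)⟩⟩

theorem IsCapable.exists_surjective_ker_eq_center {G : Type u} [Group G] (h : IsCapable G) :
    ∃ (K : Type u) (_ : Group K) (π : K →* G),
      Function.Surjective π ∧ π.ker = Subgroup.center K := by
  obtain ⟨K, _, ⟨e⟩⟩ := h
  refine ⟨K, inferInstance, (e.symm : K ⧸ Subgroup.center K →* G).comp (QuotientGroup.mk' _),
    e.symm.surjective.comp (QuotientGroup.mk'_surjective _), ?_⟩
  rw [MonoidHom.ker_mulEquiv_comp, QuotientGroup.ker_mk']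

theorem not_isCapable_of_isCyclic (G : Type u) [Group G] [IsCyclic G] [Nontrivial G] :
    ¬ IsCapable G := by
  intro h
  obtain ⟨K, _, π, hπ, hker⟩ := h.exists_surjective_ker_eq_center
  have : IsMulCommutative K := π.isMulCommutative_of_isCyclic_of_ker_le_center hker.le
  obtain ⟨g, hg⟩ := exists_ne (1 : G)
  obtain ⟨k, rfl⟩ := hπ g
  refine hg (hker.ge (Subgroup.mem_center_iff.2 fun x => mul_comm' x k))

/-! ### Commutators of groups of class at most two -/

theorem commutatorElement_mem_center_of_nilpotencyClass_le_two {G : Type*} [Group G]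
    [Group.IsNilpotent G] (hclass : Group.nilpotencyClass G ≤ 2) (x y : G) :
    ⁅x, y⁆ ∈ Subgroup.center G := by
  have hx : x ∈ Subgroup.upperCentralSeries G 2 := by
    rw [Subgroup.upperCentralSeries_eq_top_iff_nilpotencyClass_le.2 hclass]
    exact Subgroup.mem_top x
  rw [← Subgroup.upperCentralSeries_one]
  exact Subgroup.mem_upperCentralSeries_succ_iff.1 hx y

section CommutatorHom

variable {G : Type*} [Group G]

/-- The commutator of a group of class at most two, as a bimultiplicative map to the center. -/
def commutatorHom (hc : ∀ x y : G, ⁅x, y⁆ ∈ Subgroup.center G) :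
    G →* G →* Subgroup.center G :=
  MonoidHom.mk'
    (fun x => MonoidHom.mk' (fun y => ⟨⁅x, y⁆, hc x y⟩) fun y z => Subtype.ext <| by
      have h := Subgroup.mem_center_iff.1 (hc x z)
      calc ⁅x, y * z⁆ = ⁅x, y⁆ * (y * ⁅x, z⁆ * y⁻¹) := by
            simp only [commutatorElement_def]; group
        _ = ⁅x, y⁆ * ⁅x, z⁆ := by rw [h, mul_inv_cancel_right])
    fun x y => MonoidHom.ext fun z => Subtype.ext <| by
      have h := Subgroup.mem_center_iff.1 (hc y z)
      calc ⁅x * y, z⁆ = x * ⁅y, z⁆ * x⁻¹ * ⁅x, z⁆ := by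
            simp only [commutatorElement_def]; group
        _ = ⁅x, z⁆ * ⁅y, z⁆ := by rw [h, mul_inv_cancel_right, h]

variable (hc : ∀ x y : G, ⁅x, y⁆ ∈ Subgroup.center G)

theorem commutatorHom_eq_one_iff_commute {x y : G} : commutatorHom hc x y = 1 ↔ Commute x y :=
  Subtype.ext_iff.trans commutatorElement_eq_one_iff_commute

end CommutatorHom

/-! ### Non-capable extra-special groups -/

theorem commutatorElement_mul_left_of_mem_center {G : Type*} [Group G] {r : G}
    (hr : r ∈ Subgroup.center G) (a b : G) : ⁅r * a, b⁆ = ⁅a, b⁆ := by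
  have h : Commute r (a * b * a⁻¹) := (Subgroup.mem_center_iff.1 hr _).symm
  calc ⁅r * a, b⁆ = r * (a * b * a⁻¹) * r⁻¹ * b⁻¹ := by rw [commutatorElement_def]; group
    _ = ⁅a, b⁆ := by rw [h.eq, mul_inv_cancel_right, commutatorElement_def]

theorem commutatorElement_mul_right_of_mem_center {G : Type*} [Group G] {r : G}
    (hr : r ∈ Subgroup.center G) (a b : G) : ⁅a, r * b⁆ = ⁅a, b⁆ := by
  rw [← commutatorElement_inv, commutatorElement_mul_left_of_mem_center hr, commutatorElement_inv]

theorem commute_commutatorElement_of_mem_center {G : Type*} [Group G] {x a b : G}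
    (ha : ⁅x, a⁆ ∈ Subgroup.center G) (hb : ⁅x, b⁆ ∈ Subgroup.center G) :
    Commute x ⁅a, b⁆ := by
  have conj_eq (y : G) : x * y * x⁻¹ = ⁅x, y⁆ * y := by simp [commutatorElement_def]
  have key : x * ⁅a, b⁆ * x⁻¹ = ⁅a, b⁆ := by
    rw [conjugate_commutatorElement, conj_eq a, conj_eq b,
      commutatorElement_mul_left_of_mem_center ha, commutatorElement_mul_right_of_mem_center hb]
  exact mul_inv_eq_iff_eq_mul.1 key

/-- If `G = K / Z(K)`, then a lift of `⁅a, b⁆` to `K` commutes with every lift of `u`, hence so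
does every lift of `g`. -/
theorem not_isCapable_of_forall_mem_zpowers {G : Type u} [Group G] {g : G} (hg : g ≠ 1)
    (h : ∀ u : G, ∃ a b : G, Commute u a ∧ Commute u b ∧ g ∈ Subgroup.zpowers ⁅a, b⁆) :
    ¬ IsCapable G := by
  intro hG
  obtain ⟨K, _, π, hπ, hker⟩ := hG.exists_surjective_ker_eq_center
  obtain ⟨z, rfl⟩ := hπ g
  refine hg (hker.ge (Subgroup.mem_center_iff.2 fun x => ?_))
  obtain ⟨a, b, ha, hb, j, hj⟩ := h (π x)
  obtain ⟨a, rfl⟩ := hπ a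
  obtain ⟨b, rfl⟩ := hπ b
  have mem_center_of_commute {y : K} (hy : Commute (π x) (π y)) : ⁅x, y⁆ ∈ Subgroup.center K := by
    rw [← hker, MonoidHom.mem_ker, map_commutatorElement, commutatorElement_eq_one_iff_commute]
    exact hy
  have hcomm : Commute x ⁅a, b⁆ :=
    commute_commutatorElement_of_mem_center (mem_center_of_commute ha) (mem_center_of_commute hb)
  have hz : z * (⁅a, b⁆ ^ j)⁻¹ ∈ Subgroup.center K := by
    rw [← hker, MonoidHom.mem_ker, map_mul, map_inv, map_zpow, map_commutatorElement]
    exact mul_inv_eq_one.2 hj.symm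
  have hxz : Commute x (z * (⁅a, b⁆ ^ j)⁻¹ * ⁅a, b⁆ ^ j) :=
    Commute.mul_right (Subgroup.mem_center_iff.1 hz x) (hcomm.zpow_right j)
  rwa [inv_mul_cancel_right] at hxz

namespace IsExtraSpecial

variable {p : ℕ} {G : Type u} [Group G]

theorem commutatorElement_mem_center (hG : IsExtraSpecial p G) (x y : G) :
    ⁅x, y⁆ ∈ Subgroup.center G := by
  rw [← QuotientGroup.eq_one_iff, ← QuotientGroup.mk'_apply, map_commutatorElement,
    commutatorElement_eq_one_iff_mul_comm]
  exact hG.comm_quotient _ _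

theorem exists_not_commute (hG : IsExtraSpecial p G) : ∃ a b : G, ¬ Commute a b := by
  by_contra! h
  have := hG.nontrivial_quotient
  exact QuotientGroup.nontrivial_iff.1 this
    (eq_top_iff.2 fun a _ => Subgroup.mem_center_iff.2 fun b => h b a)

theorem not_isCyclic (hG : IsExtraSpecial p G) : ¬ IsCyclic G := by
  intro hcyc
  obtain ⟨a, b, hab⟩ := hG.exists_not_commute
  exact hab (mul_comm' a b)

theorem mem_zpowers_of_mem_center [Fact p.Prime] (hG : IsExtraSpecial p G) {z g : G}
    (hz : z ∈ Subgroup.center G) (hz1 : z ≠ 1) (hg : g ∈ Subgroup.center G) :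
    g ∈ Subgroup.zpowers z := by
  obtain ⟨j, hj⟩ := mem_zpowers_of_prime_card (g := ⟨z, hz⟩) (g' := ⟨g, hg⟩) hG.card_center
    (fun h => hz1 (congrArg Subtype.val h))
  exact ⟨j, congrArg Subtype.val hj⟩

/-- The elements that commute with `u` and `t` form a subgroup of index at most `p ^ 2`. -/
theorem exists_notMem_center_commute_commute [Fact p.Prime] (hG : IsExtraSpecial p G)
    (hcard : p ^ 3 < Nat.card G) (u t : G) :
    ∃ n ∉ Subgroup.center G, Commute u n ∧ Commute t n := by
  let κ := commutatorHom hG.commutatorElement_mem_center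
  let φ : G →* Subgroup.center G × Subgroup.center G := (κ u).prod (κ t)
  have hfin : Finite (Subgroup.center G) :=
    Nat.finite_of_card_ne_zero (hG.card_center ▸ (Fact.out : p.Prime).ne_zero)
  suffices ∃ n ∈ φ.ker, n ∉ Subgroup.center G by
    obtain ⟨n, hn, hnZ⟩ := this
    obtain ⟨hu, ht⟩ := Prod.ext_iff.1 (MonoidHom.mem_ker.1 hn)
    exact ⟨n, hnZ, (commutatorHom_eq_one_iff_commute _).1 hu,
      (commutatorHom_eq_one_iff_commute _).1 ht⟩
  by_contra! hle
  refine hcard.not_ge ?_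
  calc Nat.card G = Nat.card φ.ker * φ.ker.index := φ.ker.card_mul_index.symm
    _ = Nat.card φ.ker * Nat.card φ.range := by rw [Subgroup.index_ker]
    _ ≤ Nat.card (Subgroup.center G) * Nat.card (Subgroup.center G × Subgroup.center G) :=
        Nat.mul_le_mul (Subgroup.card_le_of_le hle) (Subgroup.card_le_card_group _)
    _ = p ^ 3 := by rw [Nat.card_prod, hG.card_center]; ring

theorem exists_commute_commute_not_commute [Fact p.Prime] (hG : IsExtraSpecial p G)
    (hcard : p ^ 3 < Nat.card G) (u : G) :
    ∃ a b : G, Commute u a ∧ Commute u b ∧ ¬ Commute a b := by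
  let κ := commutatorHom hG.commutatorElement_mem_center
  by_contra! habelian
  obtain ⟨t, hut⟩ : ∃ t, ¬ Commute u t := by
    by_contra! hu
    obtain ⟨a, b, hab⟩ := hG.exists_not_commute
    exact hab (habelian a b (hu a) (hu b))
  obtain ⟨n, hn, hun, htn⟩ := hG.exists_notMem_center_commute_commute hcard u t
  refine hn (Subgroup.mem_center_iff.2 fun m => ?_)
  -- Modulo the centralizer of `u`, every `m` is a power of `t`, and `n` commutes with both.
  obtain ⟨j, hj⟩ : κ u m ∈ Subgroup.zpowers (κ u t) :=
    mem_zpowers_of_prime_card hG.card_center (hut ∘ (commutatorHom_eq_one_iff_commute _).1)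
  have hum : Commute u (m * (t ^ j)⁻¹) := by
    rw [← commutatorHom_eq_one_iff_commute hG.commutatorElement_mem_center]
    change κ u _ = 1
    rw [map_mul, map_inv, map_zpow]
    exact mul_inv_eq_one.2 hj.symm
  have hnm : Commute (m * (t ^ j)⁻¹ * t ^ j) n :=
    (habelian _ n hum hun).mul_left (htn.zpow_left j)
  rwa [inv_mul_cancel_right] at hnm

theorem not_isCapable [Fact p.Prime] (hG : IsExtraSpecial p G) (hcard : p ^ 3 < Nat.card G) :
    ¬ IsCapable G := by
  have : Nontrivial (Subgroup.center G) := by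
    have hfin : Finite (Subgroup.center G) :=
      Nat.finite_of_card_ne_zero (hG.card_center ▸ (Fact.out : p.Prime).ne_zero)
    exact Finite.one_lt_card_iff_nontrivial.1 (hG.card_center ▸ (Fact.out : p.Prime).one_lt)
  obtain ⟨⟨g, hgZ⟩, hg⟩ := exists_ne (1 : Subgroup.center G)
  refine not_isCapable_of_forall_mem_zpowers (g := g) (fun h => hg (Subtype.ext h)) fun u => ?_
  obtain ⟨a, b, ha, hb, hab⟩ := hG.exists_commute_commute_not_commute hcard u
  exact ⟨a, b, ha, hb, hG.mem_zpowers_of_mem_center (hG.commutatorElement_mem_center a b)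
    (fun h => hab (commutatorElement_eq_one_iff_commute.1 h)) hgZ⟩

end IsExtraSpecial
/-! ### Integrating a cyclic trilinear map -/

section Potential

variable {R V N ι : Type*} [CommRing R] [AddCommGroup V] [Module R V] [AddCommGroup N] [Module R N]

/-- For each multiset of basis vectors `T` is a 1-cocycle on the vertices, integrated here starting
from the least vertex; averaging over the starting vertex would require dividing by three. -/
theorem exists_symm_sub_swap_eq [Module.Free R V] (T : V →ₗ[R] V →ₗ[R] V →ₗ[R] N)
    (halt : ∀ x, (T x).IsAlt) (hcyc : ∀ x y z, T x y z + T y z x + T z x y = 0) :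
    ∃ S : V →ₗ[R] V →ₗ[R] V →ₗ[R] N,
      (∀ x y z, S x y z = S x z y) ∧ ∀ x y z, S x y z - S y x z = T z y x := by
  let b := Module.Free.chooseBasis R V
  classical
  let := linearOrderOfSTO (WellOrderingRel (α := Module.Free.ChooseBasisIndex R V))
  let s i j k := if min j k < i then -T (b (max j k)) (b i) (b (min j k)) else 0
  have hs : ∀ i j k, s i j k - s j i k = T (b k) (b j) (b i) := by
    intro i j k
    have hcyc := hcyc (b i) (b j) (b k)
    have hself i j : T (b i) (b j) (b j) = 0 := halt _ _
    have hneg i j k : -T (b i) (b j) (b k) = T (b i) (b k) (b j) := (halt _).neg _ _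
    grind
  let S : V →ₗ[R] V →ₗ[R] V →ₗ[R] N :=
    b.constr R fun i => b.constr R fun j => b.constr R fun k => s i j k
  have hS : ∀ i j k, S (b i) (b j) (b k) = s i j k := fun i j k => by
    simp only [S, Module.Basis.constr_basis]
  have hsymm : ∀ x, S x = (S x).flip := by
    refine LinearMap.congr_fun (g := LinearMap.lflip.toLinearMap ∘ₗ S)
      (b.ext fun i => LinearMap.ext_basis b b fun j k => ?_)
    change S (b i) (b j) (b k) = S (b i) (b k) (b j)
    simp only [hS, s, min_comm, max_comm]
  have hsub : S - S.flip = (LinearMap.lflip.toLinearMap ∘ₗ T.flip).flip := by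
    refine b.ext fun i => LinearMap.ext_basis b b fun j k => ?_
    change S (b i) (b j) (b k) - S (b j) (b i) (b k) = T (b k) (b j) (b i)
    simp only [hS, hs]
  exact ⟨S, fun x y z => LinearMap.congr_fun₂ (hsymm x) y z,
    fun x y z => LinearMap.congr_fun₂ (LinearMap.congr_fun hsub x) y z⟩

end Potential

/-! ### Jacobi forms -/

section IsJacobiForm

variable {R V W : Type*} [CommRing R] [AddCommGroup V] [Module R V] [AddCommGroup W] [Module R W]
  (ω : V →ₗ[R] V →ₗ[R] W)

/-- The compatibility with `ω` that makes a pairing `B` of `V` with `W` the leading term of a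
2-cocycle, where `W` is the Lie algebra of class two with bracket `ω`. -/
def IsJacobiForm (B : V →ₗ[R] W →ₗ[R] R) : Prop :=
  ∀ x y z, B x (ω y z) + B y (ω z x) + B z (ω x y) = 0

variable {ω} in
/-- The quadratic map is `T(x, x, y) - S(x, x, y) - S(x, y, y)`, where `T(x, y, z) = B(x, ω(y, z))`
and `S` is symmetric in its last two arguments with antisymmetrization `T(z, y, x)`. -/
theorem IsJacobiForm.exists_coboundary_eq [Module.Free R V] (hω : ω.IsAlt) {B : V →ₗ[R] W →ₗ[R] R}
    (hB : IsJacobiForm ω B) :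
    ∃ q : V → V → R, (∀ x, q 0 x = 0) ∧ (∀ x, q x 0 = 0) ∧
      (∀ x y z, q x y + q (x + y) z = q y z + q x (y + z) + 2 * B x (ω y z)) ∧
      ∀ x y, q x y - q y x = 2 * (B x (ω x y) - B y (ω y x)) := by
  let T := LinearMap.lcomp R (V →ₗ[R] R) ω ∘ₗ LinearMap.llcomp R V W R ∘ₗ B
  have hT x y z : T x y z = B x (ω y z) := rfl
  have halt x : (T x).IsAlt := fun y => by rw [hT, hω, map_zero]
  have hneg x y z : T x y z = -T x z y := ((halt x).neg z y).symm
  have hcyc x y z : T x y z + T y z x + T z x y = 0 := hB x y z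
  obtain ⟨S, hsymm, hsub⟩ := exists_symm_sub_swap_eq T halt hcyc
  refine ⟨fun x y => T x x y - S x x y - S x y y, fun x => by simp, fun x => by simp,
    fun x y z => ?_, fun x y => ?_⟩
  · simp only [← hT, map_add, LinearMap.add_apply]
    linear_combination hsub x y z - hcyc x y z + hneg y x z + hneg z y x - hsymm x y z
  · simp only [← hT]
    linear_combination hsub y x y - hsub x y x + hsymm y y x - hsymm x x y +
      hneg y y x - hneg x x y

/-- The cyclic sum `x ⊗ ω(y, z) + y ⊗ ω(z, x) + z ⊗ ω(x, y)`; the Jacobi forms are the linear forms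
on `V ⊗ W` that vanish on its values. -/
def jacobiMap (hω : ω.IsAlt) : V [⋀^Fin 3]→ₗ[R] V ⊗[R] W where
  __ := MultilinearMap.mk'
    (fun v : Fin 3 → V => v 0 ⊗ₜ[R] ω (v 1) (v 2) + v 1 ⊗ₜ ω (v 2) (v 0) + v 2 ⊗ₜ ω (v 0) (v 1))
    (fun v i x y => by
      fin_cases i <;> simp [TensorProduct.tmul_add, TensorProduct.add_tmul] <;> abel)
    (fun v i c x => by
      fin_cases i <;> simp [TensorProduct.smul_tmul'])
  map_eq_zero_of_eq' v i j hij hne := by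
    have hself := hω.self_eq_zero
    have hswap (u x y : V) : u ⊗ₜ[R] ω x y + u ⊗ₜ[R] ω y x = 0 := by
      rw [← TensorProduct.tmul_add, ← hω.neg x y, add_neg_cancel, TensorProduct.tmul_zero]
    fin_cases i <;> fin_cases j <;> simp_all

variable {ω} (hω : ω.IsAlt)

@[simp] theorem jacobiMap_apply (v : Fin 3 → V) : jacobiMap ω hω v =
    v 0 ⊗ₜ ω (v 1) (v 2) + v 1 ⊗ₜ ω (v 2) (v 0) + v 2 ⊗ₜ ω (v 0) (v 1) :=
  rfl

/-- The span of the values of `jacobiMap`, presented as the image of the third exterior power. -/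
noncomputable def jacobiSubmodule : Submodule R (V ⊗[R] W) :=
  (exteriorPower.alternatingMapLinearEquiv (jacobiMap ω hω)).range

theorem jacobiMap_mem_jacobiSubmodule (v : Fin 3 → V) : jacobiMap ω hω v ∈ jacobiSubmodule hω :=
  ⟨exteriorPower.ιMulti R 3 v, exteriorPower.alternatingMapLinearEquiv_apply_ιMulti _ _⟩

end IsJacobiForm

section Field

variable {k V W : Type*} [Field k] [AddCommGroup V] [Module k V] [AddCommGroup W] [Module k W]
  {ω : V →ₗ[k] V →ₗ[k] W} (hω : ω.IsAlt)

instance [Module.Finite k V] : Module.Finite k (jacobiSubmodule hω) :=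
  inferInstanceAs (Module.Finite k (LinearMap.range _))

theorem finrank_jacobiSubmodule_le [Module.Finite k V] :
    Module.finrank k (jacobiSubmodule hω) ≤ (Module.finrank k V).choose 3 :=
  (LinearMap.finrank_range_le _).trans_eq (exteriorPower.finrank_eq k 3)

theorem exists_isJacobiForm_of_tmul_notMem {u : V} {z : W} (h : u ⊗ₜ z ∉ jacobiSubmodule hω) :
    ∃ B : V →ₗ[k] W →ₗ[k] k, IsJacobiForm ω B ∧ B u z ≠ 0 := by
  obtain ⟨f, hfz, hf⟩ := Submodule.exists_le_ker_of_notMem h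
  refine ⟨TensorProduct.curry f, fun x y z => ?_, hfz⟩
  simpa using hf (jacobiMap_mem_jacobiSubmodule hω ![x, y, z])

theorem tmul_right_injective {z : W} (hz : z ≠ 0) :
    Function.Injective ((TensorProduct.mk k V W).flip z) := by
  obtain ⟨φ, hφ⟩ : ∃ φ : Module.Dual k W, φ z ≠ 0 := by
    by_contra! h
    exact hz ((Module.forall_dual_apply_eq_zero_iff k z).1 h)
  refine (injective_iff_map_eq_zero _).2 fun u hu => ?_
  simpa [hφ] using congrArg ((TensorProduct.rid k V).toLinearMap ∘ₗ φ.lTensor V) hu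

theorem range_tmul_right_le_jacobiSubmodule {z : W}
    (h : ∀ B, IsJacobiForm ω B → ∀ u, B u z = 0) :
    ((TensorProduct.mk k V W).flip z).range ≤ jacobiSubmodule hω := by
  rintro _ ⟨u, rfl⟩
  by_contra hu
  obtain ⟨B, hB, hBu⟩ := exists_isJacobiForm_of_tmul_notMem hω hu
  exact hBu (h B hB u)

include hω in
theorem exists_isJacobiForm_apply_ne_zero [Module.Finite k V]
    (hdim : (Module.finrank k V).choose 3 < Module.finrank k V) {z : W} (hz : z ≠ 0) :
    ∃ B : V →ₗ[k] W →ₗ[k] k, IsJacobiForm ω B ∧ ∃ u, B u z ≠ 0 := by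
  by_contra! h
  have hle := Submodule.finrank_mono (range_tmul_right_le_jacobiSubmodule hω h)
  rw [LinearMap.finrank_range_of_inj (tmul_right_injective hz)] at hle
  exact (hle.trans (finrank_jacobiSubmodule_le hω)).not_gt hdim

include hω in
/-- Equality of dimensions forces the cyclic sums to lie in `V ⊗ z`. -/
theorem apply_smul_add_cyclic_eq_zero [Module.Finite k V]
    (hdim : (Module.finrank k V).choose 3 ≤ Module.finrank k V) {z : W} (hz : z ≠ 0)
    (h : ∀ B, IsJacobiForm ω B → ∀ u, B u z = 0) {φ : W →ₗ[k] k} (hφ : φ z = 0) (x y w : V) :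
    φ (ω y w) • x + φ (ω w x) • y + φ (ω x y) • w = 0 := by
  have hrange : ((TensorProduct.mk k V W).flip z).range = jacobiSubmodule hω :=
    Submodule.eq_of_le_of_finrank_le (range_tmul_right_le_jacobiSubmodule hω h) <| by
      rw [LinearMap.finrank_range_of_inj (tmul_right_injective hz)]
      exact (finrank_jacobiSubmodule_le hω).trans hdim
  obtain ⟨u, hu⟩ := hrange.ge (jacobiMap_mem_jacobiSubmodule hω ![x, y, w])
  simpa [hφ] using (congrArg ((TensorProduct.rid k V).toLinearMap ∘ₗ φ.lTensor V) hu).symm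

theorem eq_zero_of_smul_add_cyclic_eq_zero (hdim : 2 < Module.finrank k V) {f : V → V → k}
    (hf : ∀ x y w, f y w • x + f w x • y + f x y • w = 0) (x y : V) : f x y = 0 := by
  by_contra hxy
  have hspan : ⊤ ≤ Submodule.span k (Set.range ![x, y]) := by
    rintro w -
    have hw : f x y • w ∈ Submodule.span k (Set.range ![x, y]) := by
      rw [← neg_eq_of_add_eq_zero_right (hf x y w)]
      refine Submodule.neg_mem _ (Submodule.add_mem _ ?_ ?_) <;>
        exact Submodule.smul_mem _ _ (Submodule.subset_span (by simp))
    exact (Submodule.smul_mem_iff _ hxy).1 hw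
  have hle := finrank_range_le_card (R := k) ![x, y]
  rw [Set.finrank, top_le_iff.1 hspan, finrank_top, Fintype.card_fin] at hle
  exact hdim.not_ge hle

include hω in
theorem mem_span_singleton_of_forall_isJacobiForm [Module.Finite k V]
    (hdim : 2 < Module.finrank k V)
    (hchoose : (Module.finrank k V).choose 3 ≤ Module.finrank k V) {z : W} (hz : z ≠ 0)
    (h : ∀ B, IsJacobiForm ω B → ∀ u, B u z = 0) (x y : V) : ω x y ∈ Submodule.span k {z} := by
  by_contra hxy
  obtain ⟨φ, hφxy, hφ⟩ := Submodule.exists_le_ker_of_notMem hxy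
  have hφz : φ z = 0 := hφ (Submodule.mem_span_singleton_self z)
  exact hφxy (eq_zero_of_smul_add_cyclic_eq_zero (f := fun x y => φ (ω x y)) hdim
    (apply_smul_add_cyclic_eq_zero hω hchoose hz h hφz) x y)

include hω in
/-- If `v ∈ ker ω`, then Jacobi forms pull back from `V ⧸ ⟨v⟩`. -/
theorem ker_eq_bot_of_forall_isJacobiForm [Module.Finite k V]
    (hdim : (Module.finrank k V - 1).choose 3 < Module.finrank k V - 1) {z : W} (hz : z ≠ 0)
    (h : ∀ B, IsJacobiForm ω B → ∀ u, B u z = 0) : ω.ker = ⊥ := by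
  refine (Submodule.eq_bot_iff _).2 fun v hv => ?_
  by_contra hv0
  let L := Submodule.span k {v}
  let ω' := hω.isRefl.liftQ₂ ω L ((Submodule.span_singleton_le_iff_mem _ _).2 hv)
  have hω' : ω'.IsAlt := fun x => by
    obtain ⟨x, rfl⟩ := L.mkQ_surjective x
    exact hω x
  have hfinrank : Module.finrank k (V ⧸ L) = Module.finrank k V - 1 := by
    rw [Submodule.finrank_quotient, finrank_span_singleton hv0]
  obtain ⟨B, hB, u, hu⟩ := exists_isJacobiForm_apply_ne_zero hω' (hfinrank ▸ hdim) hz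
  obtain ⟨u, rfl⟩ := L.mkQ_surjective u
  exact hu (h (B ∘ₗ L.mkQ) (fun x y w => hB (L.mkQ x) (L.mkQ y) (L.mkQ w)) u)

include hω in
theorem exists_isJacobiForm_apply_ne_zero_or [Module.Finite k V] [Nontrivial V]
    (hdim : Module.finrank k V ≤ 4) {z : W} (hz : z ≠ 0) :
    (∃ B : V →ₗ[k] W →ₗ[k] k, IsJacobiForm ω B ∧ ∃ u, B u z ≠ 0) ∨
      (Module.finrank k V = 4 ∧ (∀ x y, ω x y ∈ Submodule.span k {z}) ∧ ω.ker = ⊥) := by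
  refine or_iff_not_imp_left.2 fun h => ?_
  have hpos := Module.finrank_pos (R := k) (M := V)
  have hfour : Module.finrank k V = 4 := by
    have hnot := mt (exists_isJacobiForm_apply_ne_zero hω · hz) h
    interval_cases Module.finrank k V <;> simp_all [Nat.choose]
  push Not at h
  refine ⟨hfour, mem_span_singleton_of_forall_isJacobiForm hω ?_ ?_ hz h,
    ker_eq_bot_of_forall_isJacobiForm hω ?_ hz h⟩ <;> rw [hfour] <;> decide

end Field

/-! ### The Baer correspondence -/

/-- Groups of class at most two and exponent dividing the odd number `p`, to which the Baer
correspondence with alternating brackets over `ZMod p` applies. -/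
class IsBaerGroup (p : ℕ) (G : Type*) [Group G] : Prop where
  odd : Odd p
  commutator_mem_center : ∀ x y : G, ⁅x, y⁆ ∈ Subgroup.center G
  pow_eq_one : ∀ x : G, x ^ p = 1

/-- The additive group of the Baer correspondence: a copy of `G` with addition
`x + y = x * y * ⁅x, y⁆ ^ (p / 2)`, which is commutative since `⁅x, y⁆ ^ p = 1`. -/
def BaerSpace (_p : ℕ) (G : Type*) : Type _ := G

namespace BaerSpace

/-- The identity map, which turns the product of `G` into a truncated Baker-Campbell-Hausdorff
sum. -/
def log (p : ℕ) {G : Type*} : G ≃ BaerSpace p G := Equiv.refl G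

section AddCommGroup

variable {p : ℕ} {G : Type*} [Group G]

instance : Zero (BaerSpace p G) := ⟨log p 1⟩

instance : Neg (BaerSpace p G) := ⟨fun x => log p ((log p).symm x)⁻¹⟩

theorem log_one : log p (1 : G) = 0 := rfl

theorem log_inv (x : G) : log p x⁻¹ = -log p x := rfl

theorem log_commutatorElement_of_commute {x y : G} (h : Commute x y) : log p ⁅x, y⁆ = 0 := by
  rw [commutatorElement_eq_one_iff_commute.2 h, log_one]

theorem commute_coe_center (c : Subgroup.center G) (x : G) : Commute (c : G) x :=
  (Subgroup.mem_center_iff.1 c.2 x).symm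

variable [hG : IsBaerGroup p G]

/-- The correction term `⁅x, y⁆ ^ (p / 2)` in the addition of `BaerSpace p G`. -/
def twist (p : ℕ) {G : Type*} [Group G] [hG : IsBaerGroup p G] (x y : G) : Subgroup.center G :=
  commutatorHom hG.commutator_mem_center x y ^ (p / 2)

theorem twist_mul_left (x y z : G) : twist p (x * y) z = twist p x z * twist p y z := by
  simp only [twist, map_mul, MonoidHom.mul_apply, mul_pow]

theorem twist_mul_right (x y z : G) : twist p x (y * z) = twist p x y * twist p x z := by
  simp only [twist, map_mul, mul_pow]

theorem twist_eq_one_of_commute {x y : G} (h : Commute x y) : twist p x y = 1 := by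
  rw [twist, (commutatorHom_eq_one_iff_commute _).2 h, one_pow]

theorem commutatorElement_mul_twist (x y : G) : ⁅x, y⁆ * twist p x y = twist p y x := by
  have h : p / 2 + 1 + p / 2 = p := by have := Nat.two_mul_div_two_add_one_of_odd hG.odd; lia
  change ⁅x, y⁆ * ⁅x, y⁆ ^ (p / 2) = ⁅y, x⁆ ^ (p / 2)
  rw [← pow_succ', ← commutatorElement_inv x y, inv_pow, eq_inv_iff_mul_eq_one, ← pow_add, h,
    hG.pow_eq_one]

instance : Add (BaerSpace p G) := ⟨fun x y =>
  log p ((log p).symm x * (log p).symm y * twist p ((log p).symm x) ((log p).symm y))⟩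

theorem log_mul_twist (x y : G) : log p (x * y * twist p x y) = log p x + log p y := rfl

theorem log_mul_of_commute {x y : G} (h : Commute x y) : log p (x * y) = log p x + log p y := by
  rw [← log_mul_twist, twist_eq_one_of_commute h, OneMemClass.coe_one, mul_one]

theorem mul_twist_assoc (x y z : G) :
    x * y * twist p x y * z * twist p (x * y * twist p x y) z =
      x * (y * z * twist p y z) * twist p x (y * z * twist p y z) := by
  have hxy := twist_eq_one_of_commute (p := p) (commute_coe_center (twist p x y) z)
  have hyz := twist_eq_one_of_commute (p := p) (commute_coe_center (twist p y z) x).symm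
  have hz := (commute_coe_center (twist p x y) z).eq
  have hcenter := (commute_coe_center (twist p x y * twist p x z) (twist p y z : G)).eq
  simp only [twist_mul_left, twist_mul_right, hxy, hyz, mul_one, Subgroup.coe_mul] at hcenter ⊢
  rw [mul_assoc _ _ z, hz]
  simp only [mul_assoc] at hcenter ⊢
  rw [hcenter]

instance : AddCommGroup (BaerSpace p G) where
  __ : AddGroup (BaerSpace p G) := AddGroup.ofLeftAxioms
    ((log p).surjective.forall₃.2 fun x y z => congrArg (log p) (mul_twist_assoc x y z))
    (fun x => by
      obtain ⟨x, rfl⟩ := (log p).surjective x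
      rw [← log_one, ← log_mul_of_commute (Commute.one_left x), one_mul])
    (fun x => by
      obtain ⟨x, rfl⟩ := (log p).surjective x
      rw [← log_inv, ← log_mul_of_commute (Commute.refl x).inv_left, inv_mul_cancel, log_one])
  add_comm := by
    refine (log p).surjective.forall₂.2 fun x y => ?_
    rw [← log_mul_twist, ← log_mul_twist, ← commutatorElement_mul_twist x y, ← mul_assoc,
      Subgroup.mem_center_iff.1 (hG.commutator_mem_center x y) (y * x)]
    simp [commutatorElement_def]

theorem log_pow (x : G) (n : ℕ) : log p (x ^ n) = n • log p x := by
  induction n with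
  | zero => rw [pow_zero, log_one, zero_nsmul]
  | succ n ih => rw [pow_succ, log_mul_of_commute (Commute.pow_self x n), ih, succ_nsmul]

instance : Module (ZMod p) (BaerSpace p G) :=
  AddCommGroup.zmodModule <| (log p).surjective.forall.2 fun x => by
    rw [← log_pow, hG.pow_eq_one, log_one]

theorem log_commutatorElement_mul_left (x y z : G) :
    log p ⁅x * y, z⁆ = log p ⁅x, z⁆ + log p ⁅y, z⁆ := by
  rw [← log_mul_of_commute (commute_coe_center ⟨_, hG.commutator_mem_center x z⟩ _)]
  exact congrArg (fun f : G →* Subgroup.center G => log p (f z : G))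
    (map_mul (commutatorHom hG.commutator_mem_center) x y)

theorem log_commutatorElement_mul_right (x y z : G) :
    log p ⁅x, y * z⁆ = log p ⁅x, y⁆ + log p ⁅x, z⁆ := by
  rw [← log_mul_of_commute (commute_coe_center ⟨_, hG.commutator_mem_center x y⟩ _)]
  exact congrArg (fun c : Subgroup.center G => log p (c : G))
    (map_mul (commutatorHom hG.commutator_mem_center x) y z)

/-- The commutator as a biadditive map of `BaerSpace p G`. -/
def bracketHom (p : ℕ) (G : Type*) [Group G] [hG : IsBaerGroup p G] :
    BaerSpace p G →+ BaerSpace p G →+ BaerSpace p G :=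
  AddMonoidHom.mk'
    (fun x => AddMonoidHom.mk' (fun y => log p ⁅(log p).symm x, (log p).symm y⁆)
      ((log p).surjective.forall₂.2 fun y z => by
        simp only [← log_mul_twist, Equiv.symm_apply_apply, log_commutatorElement_mul_right,
          log_commutatorElement_of_commute (commute_coe_center _ _).symm, add_zero]))
    ((log p).surjective.forall₂.2 fun x y => AddMonoidHom.ext fun z => by
      simp only [← log_mul_twist, Equiv.symm_apply_apply, log_commutatorElement_mul_left,
        log_commutatorElement_of_commute (commute_coe_center _ _), add_zero, AddMonoidHom.mk'_apply,
        AddMonoidHom.add_apply])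

/-- The alternating bracket of the Baer correspondence, given by the group commutator. -/
def bracket (p : ℕ) (G : Type*) [Group G] [hG : IsBaerGroup p G] :
    BaerSpace p G →ₗ[ZMod p] BaerSpace p G →ₗ[ZMod p] BaerSpace p G :=
  LinearMap.mk₂ (ZMod p) (fun x y => bracketHom p G x y)
    (fun x y z => by rw [map_add, AddMonoidHom.add_apply])
    (fun a x y => ZMod.map_smul ((bracketHom p G).flip y) a x)
    (fun x => map_add (bracketHom p G x))
    (fun a x y => ZMod.map_smul (bracketHom p G x) a y)

theorem bracket_log (x y : G) : bracket p G (log p x) (log p y) = log p ⁅x, y⁆ := rfl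

theorem bracket_isAlt : (bracket p G).IsAlt :=
  (log p).surjective.forall.2 fun x => by rw [bracket_log, commutatorElement_self, log_one]

theorem log_mul (x y : G) :
    log p (x * y) = log p x + log p y - (p / 2) • bracket p G (log p x) (log p y) := by
  have htwist : log p (twist p x y : G) = (p / 2) • bracket p G (log p x) (log p y) := log_pow _ _
  rw [← htwist, ← log_mul_twist, log_mul_of_commute (commute_coe_center _ _).symm,
    add_sub_cancel_right]

theorem mem_center_iff_bracket_eq_zero {g : G} :
    g ∈ Subgroup.center G ↔ bracket p G (log p g) = 0 := by
  rw [Subgroup.mem_center_iff, LinearMap.ext_iff, (log p).surjective.forall]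
  refine forall_congr' fun x => ?_
  rw [bracket_log, LinearMap.zero_apply, ← log_one, (log p).injective.eq_iff,
    commutatorElement_eq_one_iff_mul_comm, eq_comm]

/-- The subspace spanned by the brackets, which corresponds to the derived subgroup of `G`. -/
def derived (p : ℕ) (G : Type*) [Group G] [IsBaerGroup p G] :
    Submodule (ZMod p) (BaerSpace p G) :=
  Submodule.span (ZMod p) (Set.range fun x : BaerSpace p G × BaerSpace p G => bracket p G x.1 x.2)

theorem bracket_mem_derived (x y : BaerSpace p G) : bracket p G x y ∈ derived p G :=
  Submodule.subset_span ⟨(x, y), rfl⟩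

theorem derived_le_iff {S : Submodule (ZMod p) (BaerSpace p G)} :
    derived p G ≤ S ↔ ∀ x y, bracket p G x y ∈ S := by
  rw [derived, Submodule.span_le, Set.range_subset_iff, Prod.forall]
  rfl

theorem derived_le_ker_bracket : derived p G ≤ (bracket p G).ker :=
  derived_le_iff.2 <| (log p).surjective.forall₂.2 fun x y => by
    rw [LinearMap.mem_ker, bracket_log, ← mem_center_iff_bracket_eq_zero]
    exact hG.commutator_mem_center x y

/-- The bracket as a form on the quotient by the derived subspace. -/
def reducedBracket (p : ℕ) (G : Type*) [Group G] [IsBaerGroup p G] :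
    (BaerSpace p G ⧸ derived p G) →ₗ[ZMod p] (BaerSpace p G ⧸ derived p G) →ₗ[ZMod p]
      BaerSpace p G :=
  bracket_isAlt.isRefl.liftQ₂ (bracket p G) (derived p G) derived_le_ker_bracket

theorem reducedBracket_mkQ (x y : BaerSpace p G) :
    reducedBracket p G ((derived p G).mkQ x) ((derived p G).mkQ y) = bracket p G x y := rfl

theorem reducedBracket_isAlt : (reducedBracket p G).IsAlt :=
  (derived p G).mkQ_surjective.forall.2 bracket_isAlt

theorem mkQ_log_mul (x y : G) : (derived p G).mkQ (log p (x * y)) =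
    (derived p G).mkQ (log p x) + (derived p G).mkQ (log p y) := by
  rw [log_mul, map_sub, map_add, sub_eq_self]
  exact (Submodule.Quotient.mk_eq_zero _).2 (nsmul_mem (bracket_mem_derived _ _) _)

theorem span_range_mkQ_log_eq_top {ι : Type*} {g : ι → G}
    (hg : Subgroup.closure (Set.range g) = ⊤) :
    Submodule.span (ZMod p) (Set.range fun i => (derived p G).mkQ (log p (g i))) = ⊤ := by
  set S := Submodule.span (ZMod p) (Set.range fun i => (derived p G).mkQ (log p (g i)))
  suffices h : ∀ x : G, (derived p G).mkQ (log p x) ∈ S by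
    rw [Submodule.eq_top_iff', (derived p G).mkQ_surjective.forall, (log p).surjective.forall]
    exact h
  intro x
  induction hg ▸ Subgroup.mem_top x using Subgroup.closure_induction with
  | mem x hx =>
    obtain ⟨i, rfl⟩ := hx
    exact Submodule.subset_span ⟨i, rfl⟩
  | one => rw [log_one, map_zero]; exact S.zero_mem
  | mul x y _ _ hx hy => rw [mkQ_log_mul]; exact S.add_mem hx hy
  | inv x _ hx => rw [log_inv, map_neg]; exact S.neg_mem hx

theorem isCyclic_of_span_eq_top {g : G}
    (hg : Submodule.span (ZMod p) {log p g} = ⊤) : IsCyclic G := by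
  have : NeZero p := ⟨hG.odd.pos.ne'⟩
  refine ⟨⟨g, fun x => ?_⟩⟩
  obtain ⟨a, ha⟩ := Submodule.mem_span_singleton.1 (hg ▸ Submodule.mem_top : log p x ∈ _)
  refine ⟨a.val, (log p).injective ?_⟩
  change log p (g ^ (a.val : ℤ)) = _
  rw [← ha, zpow_natCast, log_pow, ← Nat.cast_smul_eq_nsmul (ZMod p), ZMod.natCast_zmod_val]

theorem derived_sup_span_ne_top (hcyc : ¬ IsCyclic G) {g : G}
    (hg : g ∈ Subgroup.center G) : derived p G ⊔ Submodule.span (ZMod p) {log p g} ≠ ⊤ := by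
  intro htop
  have hbracket : (bracket p G).ker = ⊤ := top_le_iff.1 <| htop ▸
    sup_le derived_le_ker_bracket ((Submodule.span_singleton_le_iff_mem _ _).2
      (mem_center_iff_bracket_eq_zero.1 hg))
  have hderived : derived p G = ⊥ := le_bot_iff.1 <| derived_le_iff.2 fun x y => by
    rw [LinearMap.ker_eq_top.1 hbracket]
    exact Submodule.zero_mem _
  rw [hderived, bot_sup_eq] at htop
  exact hcyc (isCyclic_of_span_eq_top htop)

end AddCommGroup

end BaerSpace

/-! ### Detecting central elements -/

open BaerSpace

theorem two_mul_natCast_div_two_eq_neg_one {p : ℕ} (hp : Odd p) :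
    (2 : ZMod p) * (p / 2 : ℕ) = -1 := by
  rw [eq_neg_iff_add_eq_zero]
  exact_mod_cast (congrArg (Nat.cast : ℕ → ZMod p)
    (Nat.two_mul_div_two_add_one_of_odd hp)).trans (ZMod.natCast_self p)

section Detection

variable {p : ℕ} {G : Type*} [Group G] [hG : IsBaerGroup p G]

theorem exists_normalizedCocycle_of_isJacobiForm [Fact p.Prime]
    {B : (BaerSpace p G ⧸ derived p G) →ₗ[ZMod p] BaerSpace p G →ₗ[ZMod p] ZMod p}
    (hB : IsJacobiForm (reducedBracket p G) B) :
    ∃ c : NormalizedCocycle G (ZMod p), ∀ g ∈ Subgroup.center G, ∀ u,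
      c.toFun u g - c.toFun g u =
        4 * (B ((derived p G).mkQ (log p u)) (log p g) -
          B ((derived p G).mkQ (log p g)) (log p u)) := by
  obtain ⟨q, hq_zero, hzero_q, hδ, hswap⟩ := hB.exists_coboundary_eq reducedBracket_isAlt
  let π (x : G) := (derived p G).mkQ (log p x)
  -- The deviation of `log (y * z)` from additivity gives `4 * B` the coboundary
  -- `-2 * B x ⁅y, z⁆`, which that of `q` cancels.
  refine ⟨⟨fun x y => 4 * B (π x) (log p y) + q (π x) (π y), fun x => ?_, fun x => ?_,
    fun x y z => ?_⟩, fun g hg u => ?_⟩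
  · simp only [π, log_one, map_zero, LinearMap.zero_apply, hq_zero, mul_zero, add_zero]
  · simp only [π, log_one, map_zero, hzero_q, mul_zero, add_zero]
  · have hδ := hδ (π x) (π y) (π z)
    have hlog : B (π x) (log p (y * z)) = B (π x) (log p y) + B (π x) (log p z) -
        (p / 2 : ℕ) * B (π x) (reducedBracket p G (π y) (π z)) := by
      rw [log_mul, map_sub, map_add, map_nsmul, nsmul_eq_mul, ← reducedBracket_mkQ]
    have hπ (x y : G) : π (x * y) = π x + π y := mkQ_log_mul x y
    rw [hlog, hπ, hπ, map_add, LinearMap.add_apply]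
    linear_combination hδ + 2 * B (π x) (reducedBracket p G (π y) (π z)) *
      two_mul_natCast_div_two_eq_neg_one hG.odd
  · have hug : reducedBracket p G (π g) (π u) = 0 := by
      rw [reducedBracket_mkQ, mem_center_iff_bracket_eq_zero.1 hg, LinearMap.zero_apply]
    have hswap := hswap (π u) (π g)
    rw [hug, reducedBracket_isAlt.isRefl _ _ hug, map_zero, map_zero] at hswap
    linear_combination hswap

theorem isDetected_of_isJacobiForm [Fact p.Prime]
    {B : (BaerSpace p G ⧸ derived p G) →ₗ[ZMod p] BaerSpace p G →ₗ[ZMod p] ZMod p}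
    (hB : IsJacobiForm (reducedBracket p G) B) {g u : G} (hg : g ∈ Subgroup.center G)
    (hne : B ((derived p G).mkQ (log p u)) (log p g) ≠
      B ((derived p G).mkQ (log p g)) (log p u)) :
    IsDetected (ZMod p) g := by
  obtain ⟨c, hc⟩ := exists_normalizedCocycle_of_isJacobiForm hB
  have hfour : (4 : ZMod p) ≠ 0 := fun h => one_ne_zero (α := ZMod p) <| by
    linear_combination (p / 2 : ℕ) ^ 2 * h -
      (2 * (p / 2 : ℕ) - 1) * two_mul_natCast_div_two_eq_neg_one hG.odd
  refine ⟨c, u, sub_ne_zero.1 ?_⟩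
  rw [hc g hg u]
  exact mul_ne_zero hfour (sub_ne_zero.2 hne)

/-- The product of a linear form vanishing on `g` and a linear form not vanishing on `g`, both
trivial on the brackets, is a Jacobi form. -/
theorem isDetected_of_log_notMem_derived [Fact p.Prime] (hcyc : ¬ IsCyclic G) {g : G}
    (hg : g ∈ Subgroup.center G) (hgD : log p g ∉ derived p G) : IsDetected (ZMod p) g := by
  obtain ⟨α, hαg, hα⟩ := Submodule.exists_le_ker_of_notMem hgD
  obtain ⟨β, hβ0, hβ⟩ := Submodule.exists_le_ker_of_lt_top _
    (lt_top_iff_ne_top.2 (derived_sup_span_ne_top (p := p) hcyc hg))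
  have hβg : β (log p g) = 0 := hβ (Submodule.mem_sup_right (Submodule.mem_span_singleton_self _))
  obtain ⟨u, hu⟩ : ∃ u, β (log p u) ≠ 0 := by
    by_contra! h
    exact hβ0 (LinearMap.ext ((log p).surjective.forall.2 h))
  let β' := (derived p G).liftQ β (le_sup_left.trans hβ)
  have hJacobi : IsJacobiForm (reducedBracket p G) (LinearMap.smulRight β' α) := by
    have hbracket (x y : BaerSpace p G ⧸ derived p G) : α (reducedBracket p G x y) = 0 := by
      obtain ⟨x, rfl⟩ := (derived p G).mkQ_surjective x
      obtain ⟨y, rfl⟩ := (derived p G).mkQ_surjective y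
      exact hα (bracket_mem_derived x y)
    intro x y z
    simp only [LinearMap.smulRight_apply, LinearMap.smul_apply, hbracket, smul_zero, add_zero]
  refine isDetected_of_isJacobiForm hJacobi hg (u := u) ?_
  change β (log p u) * α (log p g) ≠ β (log p g) * α (log p u)
  rw [hβg, zero_mul]
  exact mul_ne_zero hu hαg

theorem isDetected_or_of_log_mem_derived [Fact p.Prime]
    [Module.Finite (ZMod p) (BaerSpace p G ⧸ derived p G)]
    (hdim : Module.finrank (ZMod p) (BaerSpace p G ⧸ derived p G) ≤ 4) (hcyc : ¬ IsCyclic G)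
    {g : G} (hg : g ∈ Subgroup.center G) (hg1 : g ≠ 1) (hgD : log p g ∈ derived p G) :
    IsDetected (ZMod p) g ∨
      (Module.finrank (ZMod p) (BaerSpace p G ⧸ derived p G) = 4 ∧
        derived p G = Submodule.span (ZMod p) {log p g} ∧
        ∀ x ∈ Subgroup.center G, log p x ∈ derived p G) := by
  have hspan : Submodule.span (ZMod p) {log p g} ≤ derived p G :=
    (Submodule.span_singleton_le_iff_mem _ _).2 hgD
  have : Nontrivial (BaerSpace p G ⧸ derived p G) :=
    Submodule.Quotient.nontrivial_iff.2 fun h =>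
      derived_sup_span_ne_top (p := p) hcyc hg ((sup_eq_left.2 hspan).trans h)
  have hlog : log p g ≠ 0 := fun h => hg1 ((log p).injective h)
  refine (exists_isJacobiForm_apply_ne_zero_or reducedBracket_isAlt hdim hlog).imp ?_ ?_
  · rintro ⟨B, hB, u, hu⟩
    obtain ⟨u, rfl⟩ := (derived p G).mkQ_surjective u
    obtain ⟨u, rfl⟩ := (log p).surjective u
    refine isDetected_of_isJacobiForm hB hg (u := u) ?_
    rwa [show (derived p G).mkQ (log p g) = 0 from (Submodule.Quotient.mk_eq_zero _).2 hgD,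
      map_zero, LinearMap.zero_apply]
  · rintro ⟨hfour, hmem, hker⟩
    refine ⟨hfour, le_antisymm (derived_le_iff.2 fun x y =>
      hmem ((derived p G).mkQ x) ((derived p G).mkQ y)) hspan, fun x hx => ?_⟩
    rw [← (derived p G).ker_mkQ, LinearMap.mem_ker, ← Submodule.mem_bot (ZMod p), ← hker,
      LinearMap.mem_ker]
    refine LinearMap.ext ((derived p G).mkQ_surjective.forall.2 fun y => ?_)
    rw [reducedBracket_mkQ, mem_center_iff_bracket_eq_zero.1 hx]
    rfl

end Detection

/-! ### The trichotomy -/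

section Trichotomy

variable {p : ℕ} {G : Type u} [Group G] [hG : IsBaerGroup p G]

theorem natCard_center_eq_natCard_derived
    (h : ∀ x ∈ Subgroup.center G, log p x ∈ derived p G) :
    Nat.card (Subgroup.center G) = Nat.card (derived p G) :=
  Nat.card_congr <| (log p).subtypeEquiv fun x =>
    ⟨h x, fun hx => mem_center_iff_bracket_eq_zero.2 (derived_le_ker_bracket hx)⟩

theorem natCard_eq_pow_finrank_mul_natCard_derived [Fact p.Prime]
    [Module.Finite (ZMod p) (BaerSpace p G ⧸ derived p G)] :
    Nat.card G =
      p ^ Module.finrank (ZMod p) (BaerSpace p G ⧸ derived p G) * Nat.card (derived p G) := by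
  calc Nat.card G = Nat.card (BaerSpace p G) := Nat.card_congr (log p)
    _ = Nat.card (BaerSpace p G ⧸ derived p G) * Nat.card (derived p G) :=
        (derived p G).toAddSubgroup.card_eq_card_quotient_mul_card_addSubgroup
    _ = _ := by rw [Module.natCard_eq_pow_finrank (K := ZMod p), Nat.card_zmod]

theorem isExtraSpecial_of_natCard_center_eq [Fact p.Prime] {n : ℕ} (hn : 1 < n)
    (hcard : Nat.card G = p ^ n) (hcenter : Nat.card (Subgroup.center G) = p) :
    IsExtraSpecial p G where
  card_eq_pow := ⟨n, hcard⟩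
  card_center := hcenter
  nontrivial_quotient := by
    rw [QuotientGroup.nontrivial_iff]
    intro h
    rw [h, Subgroup.card_top, hcard] at hcenter
    exact hcenter.not_gt (lt_self_pow₀ (Fact.out : p.Prime).one_lt hn)
  comm_quotient := (QuotientGroup.mk'_surjective _).forall₂.2 fun a b => by
    rw [← commutatorElement_eq_one_iff_mul_comm, ← map_commutatorElement, QuotientGroup.mk'_apply,
      QuotientGroup.eq_one_iff]
    exact hG.commutator_mem_center a b
  pow_quotient := (QuotientGroup.mk'_surjective _).forall.2 fun a => by
    rw [← map_pow, hG.pow_eq_one, map_one]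

theorem isDetected_or_isExtraSpecial [Fact p.Prime]
    [Module.Finite (ZMod p) (BaerSpace p G ⧸ derived p G)]
    (hdim : Module.finrank (ZMod p) (BaerSpace p G ⧸ derived p G) ≤ 4) (hcyc : ¬ IsCyclic G)
    {g : G} (hg : g ∈ Subgroup.center G) (hg1 : g ≠ 1) :
    IsDetected (ZMod p) g ∨
      (IsExtraSpecial p G ∧ Nat.card G = p ^ 5 ∧ Monoid.exponent G = p) := by
  by_cases hgD : log p g ∈ derived p G
  swap
  · exact Or.inl (isDetected_of_log_notMem_derived hcyc hg hgD)
  refine (isDetected_or_of_log_mem_derived hdim hcyc hg hg1 hgD).imp_right ?_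
  rintro ⟨hfour, hderived, hcenter⟩
  have hlog : log p g ≠ 0 := fun h => hg1 ((log p).injective h)
  have hcardD : Nat.card (derived p G) = p := by
    rw [hderived, Module.natCard_eq_pow_finrank (K := ZMod p), finrank_span_singleton hlog,
      Nat.card_zmod, pow_one]
  have hcard : Nat.card G = p ^ 5 := by
    rw [natCard_eq_pow_finrank_mul_natCard_derived (p := p), hfour, hcardD, ← pow_succ]
  have : Nontrivial G := nontrivial_of_ne g 1 hg1
  refine ⟨isExtraSpecial_of_natCard_center_eq (by decide : 1 < 5) hcard
    ((natCard_center_eq_natCard_derived hcenter).trans hcardD), hcard, ?_⟩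
  exact (Monoid.exponent_eq_prime_iff Fact.out).2 fun x hx =>
    orderOf_eq_prime (hG.pow_eq_one x) hx

theorem isCapable_or_isExtraSpecial [Fact p.Prime] (hgen : IsGeneratedBy 4 G)
    (hcyc : ¬ (IsCyclic G ∧ Nontrivial G)) :
    IsCapable G ∨ (IsExtraSpecial p G ∧ Nat.card G = p ^ 5 ∧ Monoid.exponent G = p) := by
  obtain ⟨s, hs⟩ := hgen
  have hspan := span_range_mkQ_log_eq_top (p := p) hs
  have : Module.Finite (ZMod p) (BaerSpace p G ⧸ derived p G) :=
    Module.Finite.of_fg_top (hspan ▸ Submodule.fg_span (Set.finite_range _))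
  have hdim : Module.finrank (ZMod p) (BaerSpace p G ⧸ derived p G) ≤ 4 := by
    have := finrank_range_le_card (R := ZMod p) fun i => (derived p G).mkQ (log p (s i))
    rwa [Set.finrank, hspan, finrank_top, Fintype.card_fin] at this
  refine or_iff_not_imp_right.2 fun hes =>
    isCapable_of_forall_isDetected (ZMod p) fun g hg hg1 => ?_
  exact (isDetected_or_isExtraSpecial hdim (fun h => hcyc ⟨h, nontrivial_of_ne g 1 hg1⟩) hg
    hg1).resolve_right hes

end Trichotomy

theorem mainTheorem1 (p : ℕ) (hp : p.Prime) (hodd : Odd p) (G : Type u) [Group G]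
    (hgen : IsGeneratedBy 4 G)
    (hnil : Group.IsNilpotent G) (hclass : Group.nilpotencyClass G ≤ 2)
    (hexp : ∀ g : G, g ^ p = 1) :
    ExactlyOne
      (IsCyclic G ∧ Nontrivial G)
      (IsExtraSpecial p G ∧ Nat.card G = p ^ 5 ∧ Monoid.exponent G = p)
      (IsCapable G) := by
  have : Fact p.Prime := ⟨hp⟩
  have : IsBaerGroup p G :=
    ⟨hodd, commutatorElement_mem_center_of_nilpotencyClass_le_two hclass, hexp⟩
  by_cases hcyc : IsCyclic G ∧ Nontrivial G
  · obtain ⟨_, _⟩ := hcyc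
    exact Or.inl ⟨⟨inferInstance, inferInstance⟩, fun hes => hes.1.not_isCyclic inferInstance,
      not_isCapable_of_isCyclic G⟩
  by_cases hes : IsExtraSpecial p G ∧ Nat.card G = p ^ 5 ∧ Monoid.exponent G = p
  · have hcard : p ^ 3 < Nat.card G := hes.2.1 ▸ Nat.pow_lt_pow_right hp.one_lt (by decide)
    exact Or.inr (Or.inl ⟨hcyc, hes, hes.1.not_isCapable hcard⟩)
  · exact Or.inr (Or.inr ⟨hcyc, hes, (isCapable_or_isExtraSpecial hgen hcyc).resolve_right hes⟩)
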